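/- Let $\Delta\subset\mathfrak t^*$ be a reduced crystallographic root system spanning the finite-dimensional real vector space $\mathfrak t^*$ (the roots of a semisimple complex Lie algebra), with simple roots $\alpha_1,\dots,\alpha_n$, positive roots $\Delta^+$, negative roots $\Delta^-$, and Weyl group $W$ with simple reflections $s_i=s_{\alpha_i}$, length function $\ell$ and strong Bruhat order $\preccurlyeq$. Let $\mathbb S(\mathfrak t^*)$ be the symmetric algebra with its induced $W$-action, and let $H_\alpha^*(W)$ be the $\mathbb S(\mathfrak t^*)$-algebra of maps $g\colon W\to\mathbb S(\mathfrak t^*)$ such that $g(ws_\beta)-g(w)\in(w\beta)\,\mathbb S(\mathfrak t^*)$ for all $w\in W$, $\beta\in\Delta^+$. For $u\in W$, let $\tau_u\in H_\alpha^*(W)$ be the equivariant Schubert class of $u$, that is, the unique element of $H_\alpha^*(W)$ such that (1) $\tau_u(v)$ is homogeneous of polynomial degree $\ell(u)$ for all $v\in W$; (2) $\tau_u(v)=0$ unless $u\preccurlyeq v$; (3) $\tau_u(u)=\prod\{\beta : \beta\in\Delta^+,\ u^{-1}\beta\in\Delta^-\}$. Let $\partial_i E=(E-s_i\cdot E)/\alpha_i$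 for $E\in\mathbb S(\mathfrak t^*)$, and $\partial_w=\partial_{i_1}\cdots\partial_{i_m}$ for a reduced decomposition $w=s_{i_1}\cdots s_{i_m}$. These objects are well defined: each $\tau_u$ exists and is unique, and $\partial_w$ does not depend on the reduced decomposition. For $f\in\mathbb S(\mathfrak t^*)$ let $c_f\in H_\alpha^*(W)$ be the $W$-invariant class $c_f(v)=v\cdot f$. Then $$c_f=\sum_{w\in W}(-1)^{\ell(w)}\,(\partial_w f)\,\tau_w .$$ -/

import Mathlib

open RootPairing

noncomputable section

namespace FlagGKM

variable {ι V N : Type*} [AddCommGroup V] [Module ℝ V] [AddCommGroup N] [Module ℝ N]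

section Weyl

variable (P : RootPairing ι ℝ V N)

/-- The Weyl group of a finite root system is finite. -/
instance finite_weylGroup [Finite ι] [P.IsRootSystem] : Finite P.weylGroup := by
  refine Finite.of_injective (fun w : P.weylGroup => P.weylGroupToPerm w) ?_
  intro w w' h
  apply Subtype.ext
  apply RootPairing.Equiv.weightHom_injective
  apply LinearEquiv.toLinearMap_injective
  refine LinearMap.ext_on_range (v := P.root)
    (IsRootSystem.span_root_eq_top (P := P)) fun i => ?_
  have h1 := P.weylGroup_apply_root w i
  have h2 := P.weylGroup_apply_root w' i
  have h3 : P.weylGroupToPerm w = P.weylGroupToPerm w' := h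
  rw [h3, ← h2] at h1
  exact h1

instance fintype_weylGroup [Finite ι] [P.IsRootSystem] : Fintype P.weylGroup :=
  Fintype.ofFinite _

/-- The symmetric algebra `S(𝔱*)`, where `𝔱* = V` is the real span of the roots. -/
abbrev Sym (V : Type*) [AddCommGroup V] [Module ℝ V] : Type _ := SymmetricAlgebra ℝ V

/-- The inclusion `𝔱* → S(𝔱*)`. -/
abbrev lin : V →ₗ[ℝ] Sym V := SymmetricAlgebra.ι ℝ V

/-- `f ∈ S^d(𝔱*)`: `f` is a sum of products of `d` elements of `𝔱*`. -/
def IsHomogeneousOfDegree (d : ℕ) (f : Sym V) : Prop :=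
  f ∈ (LinearMap.range (lin : V →ₗ[ℝ] Sym V)) ^ d

/-- The action of the Weyl group on `S(𝔱*)` by algebra automorphisms extending the action
on `𝔱*`. -/
def act (w : P.weylGroup) : Sym V →ₐ[ℝ] Sym V :=
  SymmetricAlgebra.lift (lin ∘ₗ DistribSMul.toLinearMap ℝ V w)

@[simp] lemma act_lin (w : P.weylGroup) (x : V) : act P w (lin x) = lin (w • x) := by
  simp [act]

@[simp] lemma act_one (f : Sym V) : act P 1 f = f := by
  have : act P 1 = AlgHom.id ℝ (Sym V) := by
    apply SymmetricAlgebra.algHom_ext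
    ext x
    simp
  rw [this]; rfl

lemma act_mul (v w : P.weylGroup) (f : Sym V) : act P (v * w) f = act P v (act P w f) := by
  have : act P (v * w) = (act P v).comp (act P w) := by
    apply SymmetricAlgebra.algHom_ext
    ext x
    simp [mul_smul]
  rw [this]; rfl

/-- `α` divides `f - s_α f`. -/
lemma root_dvd_sub (i : ι) (f : Sym V) :
    lin (P.root i) ∣ f - act P (weylGroup.ofIdx P i) f := by
  induction f using SymmetricAlgebra.induction with
  | algebraMap r => simp
  | ι x =>
    rw [act_lin, ← map_sub]
    refine ⟨algebraMap ℝ _ (P.coroot' i x), ?_⟩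
    have : x - weylGroup.ofIdx P i • x = P.coroot' i x • P.root i := by
      change x - P.reflection i x = _
      rw [P.reflection_apply, sub_sub_cancel]
    rw [this, map_smul, Algebra.smul_def, mul_comm]
  | mul a b ha hb =>
    have : a * b - act P (weylGroup.ofIdx P i) (a * b) =
        (a - act P (weylGroup.ofIdx P i) a) * b +
          act P (weylGroup.ofIdx P i) a * (b - act P (weylGroup.ofIdx P i) b) := by
      rw [map_mul]; ring
    rw [this]
    exact dvd_add (ha.mul_right _) (hb.mul_left _)
  | add a b ha hb =>
    rw [map_add, add_sub_add_comm]
    exact dvd_add ha hb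

/-- The divided difference operator `∂_i E = (E - s_i E) / α_i`; the quotient exists in `S(𝔱*)`
by `root_dvd_sub`, and is unique since `S(𝔱*)` is a domain (`divDiff_unique`). -/
def divDiff (i : ι) (E : Sym V) : Sym V := (root_dvd_sub P i E).choose

lemma root_mul_divDiff (i : ι) (E : Sym V) :
    lin (P.root i) * divDiff P i E = E - act P (weylGroup.ofIdx P i) E :=
  (root_dvd_sub P i E).choose_spec.symm

lemma divDiff_unique (i : ι) (E g : Sym V)
    (h : lin (P.root i) * g = E - act P (weylGroup.ofIdx P i) E) : g = divDiff P i E := by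
  have h0 : (lin (P.root i) : Sym V) ≠ 0 := by
    intro h0
    have h1 : SymmetricAlgebra.lift (P.coroot' i) (lin (P.root i)) = (2 : ℝ) := by simp
    rw [h0, map_zero] at h1
    norm_num at h1
  exact mul_left_cancel₀ h0 (h.trans (root_mul_divDiff P i E).symm)

end Weyl

section Based

variable {P : RootPairing ι ℝ V N} (b : P.Base)

/-- The product `s_{i₁} ⋯ s_{i_m}` of a word in the simple reflections. -/
def wordProd (ω : List b.support) : P.weylGroup :=
  (ω.map fun i => weylGroup.ofIdx P (i : ι)).prod

/-- The length of `w` is the smallest length of a word in the simple reflections with product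
`w`. -/
def length (w : P.weylGroup) : ℕ := sInf {n | ∃ ω, wordProd b ω = w ∧ ω.length = n}

/-- A word in the simple reflections which is a reduced decomposition of its product. -/
def IsReducedWord (ω : List b.support) : Prop := length b (wordProd b ω) = ω.length

/-- The Weyl group is generated by the simple reflections. -/
lemma exists_wordProd_eq [Finite ι] [P.IsCrystallographic] [P.IsReduced] (w : P.weylGroup) :
    ∃ ω, wordProd b ω = w := by
  have happ (ω ω' : List b.support) : wordProd b (ω ++ ω') = wordProd b ω * wordProd b ω' := by
    simp [wordProd]
  have key (i : ι) : ∃ ω, wordProd b ω = weylGroup.ofIdx P i := by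
    refine b.induction_reflect i (p := fun i => ∃ ω, wordProd b ω = weylGroup.ofIdx P i) ?_ ?_ ?_
    · rintro i ⟨ω, hω⟩
      refine ⟨ω, hω.trans (Subtype.ext ?_)⟩
      apply RootPairing.Equiv.weightHom_injective
      ext x
      change P.reflection i x = P.reflection (P.reflectionPerm i i) x
      simp [P.reflection_reflectionPerm]
    · intro i hi
      exact ⟨[⟨i, hi⟩], by simp [wordProd]⟩
    · rintro i j ⟨ω, hω⟩ hj
      refine ⟨[⟨j, hj⟩] ++ (ω ++ [⟨j, hj⟩]), ?_⟩
      rw [happ, happ, hω]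
      apply Subtype.ext
      apply RootPairing.Equiv.weightHom_injective
      ext x
      change (P.weylGroup.subtype (wordProd b [⟨j, hj⟩] *
        (weylGroup.ofIdx P i * wordProd b [⟨j, hj⟩]))) • x =
        P.reflection (P.reflectionPerm j i) x
      rw [P.reflection_reflectionPerm]
      simp only [wordProd, map_mul, mul_smul]
      rfl
  obtain ⟨w, hw⟩ := w
  induction hw using weylGroup.induction with
  | mem i => exact key i
  | one => exact ⟨[], rfl⟩
  | mul x y hx hy ihx ihy =>
    obtain ⟨ω, hω⟩ := ihx
    obtain ⟨ω', hω'⟩ := ihy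
    exact ⟨ω ++ ω', by rw [happ, hω, hω']; rfl⟩

/-- Every element of the Weyl group has a reduced decomposition. -/
lemma exists_isReducedWord [Finite ι] [P.IsCrystallographic] [P.IsReduced] (w : P.weylGroup) :
    ∃ ω, IsReducedWord b ω ∧ wordProd b ω = w := by
  obtain ⟨ω, hω⟩ := exists_wordProd_eq b w
  obtain ⟨ω', h1, h2⟩ :=
    Nat.sInf_mem (s := {n | ∃ ω, wordProd b ω = w ∧ ω.length = n}) ⟨_, ω, hω, rfl⟩
  exact ⟨ω', by rw [IsReducedWord, h1, h2, length], h1⟩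

/-- The composition `∂_{i₁} ⋯ ∂_{i_m}`. -/
def wordDivDiff : List b.support → Sym V → Sym V
  | [], f => f
  | i :: ω, f => divDiff P (i : ι) (wordDivDiff ω f)

/-- The operator `∂_w = ∂_{i₁} ⋯ ∂_{i_m}`, where `w = s_{i₁} ⋯ s_{i_m}` is a reduced
decomposition. -/
def divDiffW [Finite ι] [P.IsCrystallographic] [P.IsReduced] (w : P.weylGroup) :
    Sym V → Sym V :=
  wordDivDiff b (exists_isReducedWord b w).choose

/-- The strong Bruhat order: `u ≼ v` if `v` is reached from `u` by successive multiplications by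
reflections, each of which increases the length. -/
def BruhatLE (u v : P.weylGroup) : Prop :=
  Relation.ReflTransGen
    (fun x y => (∃ i : ι, y = x * weylGroup.ofIdx P i) ∧ length b x < length b y) u v

/-- The ring `H_α^*(W)` of the GKM graph of `G/B`, as an `S(𝔱*)`-algebra: maps
`f : W → S(𝔱*)` with `f(w s_β) - f(w) ∈ (wβ) S(𝔱*)` for `w ∈ W` and `β ∈ Δ⁺`. -/
def cohomology : Subalgebra (Sym V) (P.weylGroup → Sym V) where
  carrier := {f | ∀ (w : P.weylGroup) (i : ι), b.IsPos i →
    lin (w • P.root i) ∣ f (w * weylGroup.ofIdx P i) - f w}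
  mul_mem' := by
    intro f g hf hg w i hi
    have : (f * g) (w * weylGroup.ofIdx P i) - (f * g) w =
        (f (w * weylGroup.ofIdx P i) - f w) * g (w * weylGroup.ofIdx P i) +
          f w * (g (w * weylGroup.ofIdx P i) - g w) := by
      simp only [Pi.mul_apply]; ring
    rw [this]
    exact dvd_add ((hf w i hi).mul_right _) ((hg w i hi).mul_left _)
  add_mem' := by
    intro f g hf hg w i hi
    rw [Pi.add_apply, Pi.add_apply, add_sub_add_comm]
    exact dvd_add (hf w i hi) (hg w i hi)
  algebraMap_mem' := by
    intro r w i _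
    simp [Pi.algebraMap_apply]

/-- The class `c_f = c_T(f) ∈ H_α^*(W)`, `c_f(v) = v · f`. -/
def charClass (f : Sym V) : cohomology b :=
  ⟨fun v => act P v f, by
    intro w i _
    have h := map_dvd (act P w) (root_dvd_sub P i f)
    rw [act_lin, map_sub, ← act_mul] at h
    rw [← neg_sub]
    exact h.neg_right⟩

/-- `c_f` is invariant under the action `(w · c)(v) = w⁻¹ · c(w v)` of `W` on `H_α^*(W)`. -/
lemma charClass_invariant (f : Sym V) (w v : P.weylGroup) :
    act P w⁻¹ ((charClass b f : P.weylGroup → Sym V) (w * v)) =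
      (charClass b f : P.weylGroup → Sym V) v := by
  change act P w⁻¹ (act P (w * v) f) = act P v f
  rw [← act_mul, inv_mul_cancel_left]

open scoped Classical in
/-- The defining conditions of the equivariant Schubert class of `u` (an element of `S^d(𝔱*)` has
cohomological degree `2d`). -/
structure IsSchubertClass [Fintype ι] (u : P.weylGroup) (τ : cohomology b) : Prop where
  homogeneous (v : P.weylGroup) :
    IsHomogeneousOfDegree (length b u) ((τ : P.weylGroup → Sym V) v)
  support (v : P.weylGroup) : ¬ BruhatLE b u v → (τ : P.weylGroup → Sym V) v = 0
  normalized : (τ : P.weylGroup → Sym V) u =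
    ∏ i : ι with b.IsPos i ∧ ¬ b.IsPos (u⁻¹ • i), lin (P.root i)

/-- The equivariant Schubert class `τ_u`: the class with the properties `IsSchubertClass`. -/
def schubertClass [Fintype ι] (u : P.weylGroup) : cohomology b :=
  Classical.epsilon (IsSchubertClass b u)

end Based

end FlagGKM

end

noncomputable section

namespace FlagGKM

variable {ι V N : Type*} [AddCommGroup V] [Module ℝ V] [AddCommGroup N] [Module ℝ N]

section WeylAction

variable {P : RootPairing ι ℝ V N}

lemma root_smul (w : P.weylGroup) (i : ι) : P.root (w • i) = w • P.root i :=
  (P.weylGroup_apply_root w i).symm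

lemma ofIdx_smul_index (i j : ι) : weylGroup.ofIdx P i • j = P.reflectionPerm i j := by
  apply P.root.injective
  rw [root_smul, P.root_reflectionPerm]
  rfl

lemma ofIdx_smul_vec (i : ι) (x : V) :
    weylGroup.ofIdx P i • x = x - P.coroot' i x • P.root i := by
  change P.reflection i x = _
  rw [P.reflection_apply]

lemma weylGroup_ext {w w' : P.weylGroup} (h : ∀ x : V, w • x = w' • x) : w = w' := by
  apply Subtype.ext
  apply RootPairing.Equiv.weightHom_injective
  ext x
  exact h x

@[simp] lemma ofIdx_mul_self (i : ι) : weylGroup.ofIdx P i * weylGroup.ofIdx P i = 1 := by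
  apply weylGroup_ext
  intro x
  rw [mul_smul, one_smul]
  change P.reflection i (P.reflection i x) = x
  simp

@[simp] lemma ofIdx_mul_cancel_left (i : ι) (w : P.weylGroup) :
    weylGroup.ofIdx P i * (weylGroup.ofIdx P i * w) = w := by
  rw [← mul_assoc, ofIdx_mul_self, one_mul]

@[simp] lemma ofIdx_inv (i : ι) : (weylGroup.ofIdx P i)⁻¹ = weylGroup.ofIdx P i :=
  inv_eq_of_mul_eq_one_left (ofIdx_mul_self i)

lemma ofIdx_smul_eq_conj (w : P.weylGroup) (i : ι) :
    weylGroup.ofIdx P (w • i) = w * weylGroup.ofIdx P i * w⁻¹ := by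
  obtain ⟨w, hw⟩ := w
  induction hw using weylGroup.induction generalizing i with
  | mem j =>
    apply weylGroup_ext
    intro x
    change weylGroup.ofIdx P (weylGroup.ofIdx P j • i) • x =
      (weylGroup.ofIdx P j * weylGroup.ofIdx P i * (weylGroup.ofIdx P j)⁻¹) • x
    rw [ofIdx_smul_index, ofIdx_inv, mul_smul, mul_smul]
    change P.reflection (P.reflectionPerm j i) x = _
    rw [P.reflection_reflectionPerm]
    rfl
  | one =>
    change weylGroup.ofIdx P ((1 : P.weylGroup) • i) =
      (1 : P.weylGroup) * weylGroup.ofIdx P i * (1 : P.weylGroup)⁻¹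
    simp
  | mul x y hx hy ihx ihy =>
    change weylGroup.ofIdx P (((⟨x, hx⟩ : P.weylGroup) * ⟨y, hy⟩) • i) =
      ((⟨x, hx⟩ : P.weylGroup) * ⟨y, hy⟩) * _ * ((⟨x, hx⟩ : P.weylGroup) * ⟨y, hy⟩)⁻¹
    rw [mul_smul, ihx, ihy]
    group

lemma ofIdx_mul_eq (w : P.weylGroup) (γ : ι) :
    weylGroup.ofIdx P γ * w = w * weylGroup.ofIdx P (w⁻¹ • γ) := by
  rw [ofIdx_smul_eq_conj]; simp [mul_assoc]

lemma coroot'_smul (w : P.weylGroup) (i : ι) (x : V) :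
    P.coroot' (w • i) (w • x) = P.coroot' i x := by
  have h := congrArg (fun g : P.weylGroup => g • (w • x)) (ofIdx_smul_eq_conj w i)
  simp only [mul_smul, inv_smul_smul] at h
  rw [ofIdx_smul_vec, ofIdx_smul_vec, smul_sub, sub_right_inj, root_smul, smul_comm w] at h
  have h0 : w • P.root i ≠ 0 := by
    rw [← root_smul]; exact P.ne_zero _
  exact smul_left_injective ℝ h0 h

lemma smul_neg_index (w : P.weylGroup) (i : ι) :
    w • P.reflectionPerm i i = P.reflectionPerm (w • i) (w • i) := by
  rw [← ofIdx_smul_index, ← ofIdx_smul_index, ofIdx_smul_eq_conj, mul_smul, mul_smul,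
    inv_smul_smul]

lemma ofIdx_neg (i : ι) : weylGroup.ofIdx P (P.reflectionPerm i i) = weylGroup.ofIdx P i := by
  rw [← ofIdx_smul_index, ofIdx_smul_eq_conj, ofIdx_mul_self, one_mul, ofIdx_inv]

end WeylAction

section Length

variable {P : RootPairing ι ℝ V N} {b : P.Base}

lemma isPos_neg {i : ι} : b.IsPos (P.reflectionPerm i i) ↔ ¬ b.IsPos i :=
  RootPairing.Base.IsPos.neg_iff_not b i

lemma simple_isPos (i : b.support) : b.IsPos (i : ι) := b.isPos_of_mem_support i.2

@[simp] lemma wordProd_nil : wordProd b [] = 1 := rfl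

@[simp] lemma wordProd_cons (i : b.support) (ω : List b.support) :
    wordProd b (i :: ω) = weylGroup.ofIdx P (i : ι) * wordProd b ω := by
  simp [wordProd]

lemma length_wordProd_le (ω : List b.support) : length b (wordProd b ω) ≤ ω.length :=
  Nat.sInf_le ⟨ω, rfl, rfl⟩

@[simp] lemma length_one : length b 1 = 0 :=
  Nat.le_zero.1 (length_wordProd_le (b := b) [])

variable [Finite ι] [P.IsCrystallographic] [P.IsReduced]

lemma exists_word_length_eq (w : P.weylGroup) :
    ∃ ω, wordProd b ω = w ∧ ω.length = length b w := by
  obtain ⟨ω, h1, h2⟩ := exists_isReducedWord b w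
  refine ⟨ω, h2, ?_⟩
  rw [← h2]; exact h1.symm

lemma length_simple_mul_le (i : b.support) (w : P.weylGroup) :
    length b (weylGroup.ofIdx P (i : ι) * w) ≤ length b w + 1 := by
  obtain ⟨ω, rfl, h⟩ := exists_word_length_eq (b := b) w
  rw [← wordProd_cons, ← h]
  exact length_wordProd_le (i :: ω)

lemma length_le_length_simple_mul (i : b.support) (w : P.weylGroup) :
    length b w ≤ length b (weylGroup.ofIdx P (i : ι) * w) + 1 := by
  simpa using length_simple_mul_le i (weylGroup.ofIdx P (i : ι) * w)

lemma isPos_simple_smul (i : b.support) {j : ι} (hj : b.IsPos j) (hij : j ≠ i) :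
    b.IsPos (weylGroup.ofIdx P (i : ι) • j) := by
  rw [ofIdx_smul_index]
  exact hj.reflectionPerm i.2 hij

lemma eq_of_not_isPos_simple_smul (i : b.support) {j : ι} (hj : b.IsPos j)
    (h : ¬ b.IsPos (weylGroup.ofIdx P (i : ι) • j)) : j = i :=
  not_not.1 fun hij => h (isPos_simple_smul i hj hij)

/-- The strong exchange condition. -/
lemma exists_word_mul_ofIdx (ω : List b.support) {β : ι} (hβ : b.IsPos β)
    (h : ¬ b.IsPos (wordProd b ω • β)) :
    ∃ ω', wordProd b ω' = wordProd b ω * weylGroup.ofIdx P β ∧ ω'.length + 1 = ω.length := by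
  induction ω with
  | nil => simp [hβ] at h
  | cons i ω ih =>
    by_cases hω : b.IsPos (wordProd b ω • β)
    · rw [wordProd_cons, mul_smul] at h
      have := eq_of_not_isPos_simple_smul i hω h
      refine ⟨ω, ?_, rfl⟩
      rw [wordProd_cons, ← this, ofIdx_smul_eq_conj]
      simp [mul_assoc]
    · obtain ⟨ω', h1, h2⟩ := ih hω
      exact ⟨i :: ω', by rw [wordProd_cons, wordProd_cons, h1, mul_assoc], by simp [h2]⟩

lemma length_mul_ofIdx_lt {w : P.weylGroup} {β : ι} (hβ : b.IsPos β) (h : ¬ b.IsPos (w • β)) :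
    length b (w * weylGroup.ofIdx P β) < length b w := by
  obtain ⟨ω, rfl, hω⟩ := exists_word_length_eq (b := b) w
  obtain ⟨ω', h1, h2⟩ := exists_word_mul_ofIdx ω hβ h
  rw [← h1, ← hω]
  exact (length_wordProd_le ω').trans_lt (by omega)

lemma length_mul_ofIdx_lt_iff {w : P.weylGroup} {β : ι} (hβ : b.IsPos β) :
    length b (w * weylGroup.ofIdx P β) < length b w ↔ ¬ b.IsPos (w • β) := by
  refine ⟨fun h hw => ?_, length_mul_ofIdx_lt hβ⟩
  have : length b (w * weylGroup.ofIdx P β * weylGroup.ofIdx P β) <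
      length b (w * weylGroup.ofIdx P β) := by
    apply length_mul_ofIdx_lt hβ
    rw [mul_smul, ofIdx_smul_index, smul_neg_index, isPos_neg]
    exact not_not.2 hw
  rw [mul_assoc, ofIdx_mul_self, mul_one] at this
  omega

lemma lt_length_mul_ofIdx_iff {w : P.weylGroup} {β : ι} (hβ : b.IsPos β) :
    length b w < length b (w * weylGroup.ofIdx P β) ↔ b.IsPos (w • β) := by
  have := length_mul_ofIdx_lt_iff (b := b) (w := w * weylGroup.ofIdx P β) hβ
  rwa [mul_assoc, ofIdx_mul_self, mul_one, mul_smul, ofIdx_smul_index, smul_neg_index, isPos_neg,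
    not_not] at this

lemma lt_length_ofIdx_mul_iff {w : P.weylGroup} {γ : ι} (hγ : b.IsPos γ) :
    length b w < length b (weylGroup.ofIdx P γ * w) ↔ b.IsPos (w⁻¹ • γ) := by
  rw [ofIdx_mul_eq]
  by_cases h : b.IsPos (w⁻¹ • γ)
  · rw [lt_length_mul_ofIdx_iff h, smul_inv_smul]
    simp [h, hγ]
  · rw [← ofIdx_neg, lt_length_mul_ofIdx_iff (isPos_neg.2 h), smul_neg_index, smul_inv_smul,
      isPos_neg]
    simp [h, hγ]

lemma length_ofIdx_mul_lt_iff {w : P.weylGroup} {γ : ι} (hγ : b.IsPos γ) :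
    length b (weylGroup.ofIdx P γ * w) < length b w ↔ ¬ b.IsPos (w⁻¹ • γ) := by
  have := lt_length_ofIdx_mul_iff (b := b) (w := weylGroup.ofIdx P γ * w) hγ
  rwa [ofIdx_mul_cancel_left, mul_inv_rev, ofIdx_inv, mul_smul, ofIdx_smul_index, smul_neg_index,
    isPos_neg] at this

lemma length_simple_mul_of_isPos (i : b.support) {w : P.weylGroup}
    (h : b.IsPos (w⁻¹ • (i : ι))) :
    length b (weylGroup.ofIdx P (i : ι) * w) = length b w + 1 :=
  le_antisymm (length_simple_mul_le i w)
    ((lt_length_ofIdx_mul_iff (simple_isPos i)).2 h)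

lemma length_simple_mul_of_not_isPos (i : b.support) {w : P.weylGroup}
    (h : ¬ b.IsPos (w⁻¹ • (i : ι))) :
    length b (weylGroup.ofIdx P (i : ι) * w) + 1 = length b w :=
  le_antisymm ((length_ofIdx_mul_lt_iff (simple_isPos i)).2 h)
    (length_le_length_simple_mul i w)

lemma isPos_of_length_simple_mul {i : b.support} {w : P.weylGroup}
    (h : length b (weylGroup.ofIdx P (i : ι) * w) = length b w + 1) :
    b.IsPos (w⁻¹ • (i : ι)) :=
  (lt_length_ofIdx_mul_iff (simple_isPos i)).1 (by omega)

lemma IsReducedWord.tail {i : b.support} {ω : List b.support} (h : IsReducedWord b (i :: ω)) :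
    IsReducedWord b ω := by
  have h1 := length_simple_mul_le i (wordProd b ω)
  have h2 := length_wordProd_le ω
  rw [IsReducedWord, wordProd_cons, List.length_cons] at h
  rw [IsReducedWord]
  omega

lemma IsReducedWord.length_cons {i : b.support} {ω : List b.support}
    (h : IsReducedWord b (i :: ω)) :
    length b (weylGroup.ofIdx P (i : ι) * wordProd b ω) = length b (wordProd b ω) + 1 := by
  have h1 := h.tail
  rw [IsReducedWord] at h h1
  rw [← wordProd_cons, h, h1, List.length_cons]

variable (b) in
/-- Induction on elements of the Weyl group by left multiplication with simple reflections that
increase the length. -/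
lemma weylGroup_induction_length {p : P.weylGroup → Prop} (one : p 1)
    (mul : ∀ (i : b.support) (w : P.weylGroup),
      length b (weylGroup.ofIdx P (i : ι) * w) = length b w + 1 → p w →
        p (weylGroup.ofIdx P (i : ι) * w)) (w : P.weylGroup) : p w := by
  obtain ⟨ω, h, rfl⟩ := exists_isReducedWord b w
  induction ω with
  | nil => exact one
  | cons i ω ih =>
    rw [wordProd_cons]
    exact mul i _ h.length_cons (ih h.tail)

end Length

section Inversions

open scoped Classical in
/-- The positive roots made negative by `w⁻¹`. -/
def inversions [Fintype ι] {P : RootPairing ι ℝ V N} (b : P.Base) (w : P.weylGroup) : Finset ι :=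
  {i | b.IsPos i ∧ ¬ b.IsPos (w⁻¹ • i)}

variable {P : RootPairing ι ℝ V N} {b : P.Base} [Fintype ι]

lemma mem_inversions {w : P.weylGroup} {i : ι} :
    i ∈ inversions b w ↔ b.IsPos i ∧ ¬ b.IsPos (w⁻¹ • i) := by
  classical
  simp [inversions]

@[simp] lemma inversions_one : inversions b 1 = ∅ := by
  ext i
  simp [mem_inversions]

variable [P.IsCrystallographic] [P.IsReduced]

open scoped Classical in
lemma inversions_simple_mul (i : b.support) {w : P.weylGroup}
    (h : length b (weylGroup.ofIdx P (i : ι) * w) = length b w + 1) :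
    inversions b (weylGroup.ofIdx P (i : ι) * w) =
      insert (i : ι) ((inversions b w).image (weylGroup.ofIdx P (i : ι) • ·)) := by
  have hi := isPos_of_length_simple_mul h
  ext j
  simp only [mem_inversions, Finset.mem_insert, Finset.mem_image, mul_inv_rev, ofIdx_inv, mul_smul]
  constructor
  · rintro ⟨h1, h2⟩
    by_cases hj : j = i
    · exact Or.inl hj
    · exact Or.inr ⟨weylGroup.ofIdx P (i : ι) • j, ⟨isPos_simple_smul i h1 hj, h2⟩, by
        rw [← mul_smul, ofIdx_mul_self, one_smul]⟩
  · rintro (rfl | ⟨j, ⟨h1, h2⟩, rfl⟩)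
    · refine ⟨simple_isPos i, ?_⟩
      rw [ofIdx_smul_index, smul_neg_index, isPos_neg, not_not]
      exact hi
    · rw [← mul_smul (weylGroup.ofIdx P (i : ι)), ofIdx_mul_self, one_smul]
      refine ⟨isPos_simple_smul i h1 ?_, h2⟩
      rintro rfl
      exact h2 hi

omit [P.IsCrystallographic] [P.IsReduced] in
open scoped Classical in
lemma simple_notMem_image_inversions (i : b.support) (w : P.weylGroup) :
    (i : ι) ∉ (inversions b w).image (weylGroup.ofIdx P (i : ι) • ·) := by
  simp only [Finset.mem_image, mem_inversions, not_exists, not_and]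
  rintro j ⟨h1, -⟩ h
  rw [smul_eq_iff_eq_inv_smul, ofIdx_inv, ofIdx_smul_index] at h
  rw [h] at h1
  exact isPos_neg.1 h1 (simple_isPos i)

@[to_additive sum_inversions_simple_mul]
lemma prod_inversions_simple_mul {M : Type*} [CommMonoid M] (F : ι → M) (i : b.support)
    {w : P.weylGroup} (h : length b (weylGroup.ofIdx P (i : ι) * w) = length b w + 1) :
    ∏ j ∈ inversions b (weylGroup.ofIdx P (i : ι) * w), F j =
      F i * ∏ j ∈ inversions b w, F (weylGroup.ofIdx P (i : ι) • j) := by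
  classical
  rw [inversions_simple_mul i h, Finset.prod_insert (simple_notMem_image_inversions i w),
    Finset.prod_image fun _ _ _ _ hxy => MulAction.injective _ hxy]

lemma card_inversions (w : P.weylGroup) : (inversions b w).card = length b w := by
  induction w using weylGroup_induction_length b with
  | one => simp
  | mul i w h ih =>
    rw [Finset.card_eq_sum_ones, sum_inversions_simple_mul _ i h, ← Finset.card_eq_sum_ones, ih, h,
      add_comm]

end Inversions

section Bruhat

variable {P : RootPairing ι ℝ V N} {b : P.Base}

lemma BruhatLE.refl (u : P.weylGroup) : BruhatLE b u u := Relation.ReflTransGen.refl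

lemma BruhatLE.trans {u v w : P.weylGroup} (h : BruhatLE b u v) (h' : BruhatLE b v w) :
    BruhatLE b u w := Relation.ReflTransGen.trans h h'

lemma bruhatLE_mul_ofIdx {u : P.weylGroup} {β : ι}
    (h : length b u < length b (u * weylGroup.ofIdx P β)) :
    BruhatLE b u (u * weylGroup.ofIdx P β) :=
  Relation.ReflTransGen.single ⟨⟨β, rfl⟩, h⟩

lemma bruhatLE_ofIdx_mul {u : P.weylGroup} {β : ι}
    (h : length b u < length b (weylGroup.ofIdx P β * u)) :
    BruhatLE b u (weylGroup.ofIdx P β * u) := by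
  rw [ofIdx_mul_eq] at h ⊢
  exact bruhatLE_mul_ofIdx h

lemma BruhatLE.eq_or_length_lt {u v : P.weylGroup} (h : BruhatLE b u v) :
    u = v ∨ length b u < length b v := by
  induction h with
  | refl => exact Or.inl rfl
  | tail _ h ih =>
    rcases ih with rfl | ih
    · exact Or.inr h.2
    · exact Or.inr (ih.trans h.2)

variable [Finite ι] [P.IsCrystallographic] [P.IsReduced]

lemma bruhatLE_simple_mul_or_of_mul_ofIdx (i : b.support) {x : P.weylGroup} {γ : ι}
    (h : length b x < length b (weylGroup.ofIdx P γ * x)) :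
    BruhatLE b (weylGroup.ofIdx P (i : ι) * x) (weylGroup.ofIdx P γ * x) ∨
      BruhatLE b (weylGroup.ofIdx P (i : ι) * x)
        (weylGroup.ofIdx P (i : ι) * (weylGroup.ofIdx P γ * x)) := by
  wlog hγ : b.IsPos γ generalizing γ
  · have := @this (P.reflectionPerm γ γ)
    rw [ofIdx_neg] at this
    exact this h (isPos_neg.2 hγ)
  by_cases hi : γ = i
  · subst hi
    exact Or.inl (BruhatLE.refl _)
  · right
    have hpos := (lt_length_ofIdx_mul_iff hγ).1 h
    have hs : weylGroup.ofIdx P (i : ι) * (weylGroup.ofIdx P γ * x) =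
        weylGroup.ofIdx P (weylGroup.ofIdx P (i : ι) • γ) * (weylGroup.ofIdx P (i : ι) * x) := by
      rw [ofIdx_smul_eq_conj, ofIdx_inv]
      simp [mul_assoc]
    rw [hs]
    apply bruhatLE_ofIdx_mul
    rw [lt_length_ofIdx_mul_iff (isPos_simple_smul i hγ hi), mul_inv_rev, mul_smul, inv_smul_smul]
    exact hpos

lemma BruhatLE.simple_mul_or {x y : P.weylGroup} (h : BruhatLE b x y) (i : b.support) :
    BruhatLE b (weylGroup.ofIdx P (i : ι) * x) y ∨
      BruhatLE b (weylGroup.ofIdx P (i : ι) * x) (weylGroup.ofIdx P (i : ι) * y) := by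
  induction h with
  | refl => exact Or.inr (BruhatLE.refl _)
  | @tail y z hxy hyz ih =>
    rcases ih with ih | ih
    · exact Or.inl (Relation.ReflTransGen.tail ih hyz)
    · obtain ⟨⟨β, rfl⟩, hlt⟩ := hyz
      have hz : y * weylGroup.ofIdx P β = weylGroup.ofIdx P (y • β) * y := by
        rw [ofIdx_mul_eq, inv_smul_smul]
      rw [hz] at hlt ⊢
      exact (bruhatLE_simple_mul_or_of_mul_ofIdx i hlt).imp ih.trans ih.trans

/-- The lifting property of the Bruhat order. -/
lemma BruhatLE.simple_mul {x y : P.weylGroup} (h : BruhatLE b x y) (i : b.support)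
    (hy : length b y < length b (weylGroup.ofIdx P (i : ι) * y)) :
    BruhatLE b (weylGroup.ofIdx P (i : ι) * x) (weylGroup.ofIdx P (i : ι) * y) :=
  (h.simple_mul_or i).elim (fun h => h.trans (bruhatLE_ofIdx_mul hy)) id

end Bruhat

section DivDiff

variable {P : RootPairing ι ℝ V N}

lemma divDiff_add (i : ι) (f g : Sym V) : divDiff P i (f + g) = divDiff P i f + divDiff P i g := by
  refine (divDiff_unique P i _ _ ?_).symm
  rw [mul_add, root_mul_divDiff, root_mul_divDiff, map_add]
  ring

lemma divDiff_mul (i : ι) (f g : Sym V) :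
    divDiff P i (f * g) = divDiff P i f * g + act P (weylGroup.ofIdx P i) f * divDiff P i g := by
  refine (divDiff_unique P i _ _ ?_).symm
  rw [mul_add, ← mul_assoc, root_mul_divDiff, mul_left_comm, root_mul_divDiff, map_mul]
  ring

@[simp] lemma divDiff_algebraMap (i : ι) (r : ℝ) : divDiff P i (algebraMap ℝ (Sym V) r) = 0 := by
  refine (divDiff_unique P i _ _ ?_).symm
  simp

@[simp] lemma divDiff_zero (i : ι) : divDiff P i 0 = 0 := by
  simpa using divDiff_algebraMap (P := P) i 0

@[simp] lemma divDiff_one (i : ι) : divDiff P i 1 = 0 := by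
  simpa using divDiff_algebraMap (P := P) i 1

lemma divDiff_algebraMap_mul (i : ι) (r : ℝ) (f : Sym V) :
    divDiff P i (algebraMap ℝ _ r * f) = algebraMap ℝ _ r * divDiff P i f := by
  rw [divDiff_mul, divDiff_algebraMap, zero_mul, zero_add, AlgHom.commutes]

lemma divDiff_neg (i : ι) (f : Sym V) : divDiff P i (-f) = -divDiff P i f := by
  simpa using divDiff_algebraMap_mul (P := P) i (-1) f

lemma divDiff_sub (i : ι) (f g : Sym V) : divDiff P i (f - g) = divDiff P i f - divDiff P i g := by
  rw [sub_eq_add_neg, divDiff_add, divDiff_neg, sub_eq_add_neg]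

lemma divDiff_sum {κ : Type*} (i : ι) (s : Finset κ) (F : κ → Sym V) :
    divDiff P i (∑ k ∈ s, F k) = ∑ k ∈ s, divDiff P i (F k) :=
  map_sum (AddMonoidHom.mk' (divDiff P i) (divDiff_add i)) F s

lemma divDiff_lin (i : ι) (x : V) :
    divDiff P i (lin x) = algebraMap ℝ _ (P.coroot' i x) := by
  refine (divDiff_unique P i _ _ ?_).symm
  rw [act_lin, ofIdx_smul_vec, map_sub, map_smul, Algebra.smul_def]
  ring

lemma act_eq_sub (i : ι) (f : Sym V) :
    act P (weylGroup.ofIdx P i) f = f - lin (P.root i) * divDiff P i f := by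
  rw [root_mul_divDiff, sub_sub_cancel]

lemma lin_root_ne_zero (i : ι) : (lin (P.root i) : Sym V) ≠ 0 := by
  intro h0
  have h1 : SymmetricAlgebra.lift (P.coroot' i) (lin (P.root i)) = (2 : ℝ) := by simp
  rw [h0, map_zero] at h1
  norm_num at h1

lemma act_divDiff (i : ι) (f : Sym V) :
    act P (weylGroup.ofIdx P i) (divDiff P i f) = divDiff P i f := by
  have h := congrArg (act P (weylGroup.ofIdx P i)) (root_mul_divDiff P i f)
  rw [map_mul, act_lin, map_sub, ← act_mul, ofIdx_mul_self, act_one, ← root_smul,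
    ofIdx_smul_index, P.root_reflectionPerm, P.reflection_apply_self, map_neg, neg_mul,
    neg_eq_iff_eq_neg, neg_sub, ← root_mul_divDiff] at h
  exact mul_left_cancel₀ (lin_root_ne_zero i) h

@[simp] lemma divDiff_divDiff (i : ι) (f : Sym V) : divDiff P i (divDiff P i f) = 0 := by
  refine (divDiff_unique P i _ _ ?_).symm
  rw [act_divDiff]; simp

end DivDiff

section WordDivDiff

variable {P : RootPairing ι ℝ V N} {b : P.Base}

lemma wordDivDiff_add (ω : List b.support) (f g : Sym V) :
    wordDivDiff b ω (f + g) = wordDivDiff b ω f + wordDivDiff b ω g := by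
  induction ω with
  | nil => rfl
  | cons i ω ih => simp only [wordDivDiff, ih, divDiff_add]

lemma wordDivDiff_algebraMap_mul (ω : List b.support) (r : ℝ) (f : Sym V) :
    wordDivDiff b ω (algebraMap ℝ _ r * f) = algebraMap ℝ _ r * wordDivDiff b ω f := by
  induction ω with
  | nil => rfl
  | cons i ω ih => simp only [wordDivDiff, ih, divDiff_algebraMap_mul]

lemma wordDivDiff_one {ω : List b.support} (hω : ω ≠ []) : wordDivDiff b ω 1 = 0 := by
  induction ω with
  | nil => exact absurd rfl hω
  | cons i ω ih =>
    by_cases h : ω = []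
    · subst h; simp [wordDivDiff]
    · simp [wordDivDiff, ih h]

variable [P.IsCrystallographic] [P.IsReduced]

lemma exists_word_ofIdx_mul [Fintype ι] (ω : List b.support) {β : ι}
    (hβ : β ∈ inversions b (wordProd b ω)) :
    ∃ ω', wordProd b ω' = weylGroup.ofIdx P β * wordProd b ω ∧ ω'.length + 1 = ω.length := by
  obtain ⟨h1, h2⟩ := mem_inversions.1 hβ
  rw [ofIdx_mul_eq, ← ofIdx_neg]
  refine exists_word_mul_ofIdx ω (isPos_neg.2 h2) ?_
  rw [smul_neg_index, smul_inv_smul, isPos_neg]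
  exact not_not.2 h1

variable (b) in
/-- The operator `∂_w` if `w` has length `m`, and zero otherwise. -/
def divDiffOfLength [Finite ι] (m : ℕ) (w : P.weylGroup) (f : Sym V) : Sym V :=
  if length b w = m then divDiffW b w f else 0

/-- The Leibniz rule for `∂_w` and a linear form. -/
lemma wordDivDiff_lin_mul [Fintype ι] {n : ℕ}
    (hn : ∀ ω : List b.support, ω.length < n → ∀ f,
      wordDivDiff b ω f = divDiffOfLength b ω.length (wordProd b ω) f)
    (ω : List b.support) (hω : ω.length ≤ n) (hr : IsReducedWord b ω) (x : V) (f : Sym V) :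
    wordDivDiff b ω (lin x * f) = lin (wordProd b ω • x) * wordDivDiff b ω f -
      ∑ β ∈ inversions b (wordProd b ω), algebraMap ℝ _ (P.coroot' β (wordProd b ω • x)) *
        divDiffOfLength b (ω.length - 1) (weylGroup.ofIdx P β * wordProd b ω) f := by
  induction ω with
  | nil => simp [wordDivDiff]
  | cons i ω ih =>
    rw [List.length_cons] at hω
    have key : ∀ β ∈ inversions b (wordProd b ω),
        divDiff P i (divDiffOfLength b (ω.length - 1) (weylGroup.ofIdx P β * wordProd b ω) f) =
          divDiffOfLength b ω.length (weylGroup.ofIdx P (i : ι) *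
            (weylGroup.ofIdx P β * wordProd b ω)) f := by
      intro β hβ
      obtain ⟨ω', h1, h2⟩ := exists_word_ofIdx_mul ω hβ
      have h3 := hn ω' (by omega) f
      have h4 := hn (i :: ω') (by rw [List.length_cons]; omega) f
      rw [List.length_cons, h2, wordProd_cons, h1] at h4
      rw [← h2, Nat.add_sub_cancel, ← h1, ← h3, h1, h2, ← h4]
      rfl
    have hi : P.coroot' i (weylGroup.ofIdx P (i : ι) • wordProd b ω • x) =
        -P.coroot' i (wordProd b ω • x) := by
      rw [ofIdx_smul_vec, map_sub, LinearMap.map_smul, smul_eq_mul]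
      simp
      ring
    rw [wordDivDiff, ih (by omega) hr.tail, divDiff_sub, divDiff_mul, divDiff_lin, act_lin,
      divDiff_sum, wordProd_cons, sum_inversions_simple_mul _ i hr.length_cons, List.length_cons,
      Nat.add_sub_cancel, ofIdx_mul_cancel_left, ← hn ω (by omega) f, mul_smul, hi,
      wordDivDiff, map_neg]
    have hs : ∀ β ∈ inversions b (wordProd b ω),
        divDiff P i (algebraMap ℝ _ (P.coroot' β (wordProd b ω • x)) *
          divDiffOfLength b (ω.length - 1) (weylGroup.ofIdx P β * wordProd b ω) f) =
        algebraMap ℝ _ (P.coroot' (weylGroup.ofIdx P (i : ι) • β)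
          (weylGroup.ofIdx P (i : ι) • wordProd b ω • x)) *
            divDiffOfLength b ω.length (weylGroup.ofIdx P (weylGroup.ofIdx P (i : ι) • β) *
              (weylGroup.ofIdx P (i : ι) * wordProd b ω)) f := by
      intro β hβ
      rw [divDiff_algebraMap_mul, key β hβ, coroot'_smul, ofIdx_smul_eq_conj, ofIdx_inv]
      simp only [mul_assoc, ofIdx_mul_cancel_left]
    rw [Finset.sum_congr rfl hs]
    ring

omit [P.IsCrystallographic] [P.IsReduced] in
lemma wordDivDiff_eq_of_lin_mul {ω ω' : List b.support} (hl : ω.length = ω'.length)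
    (h : ∀ (x : V) (f : Sym V), wordDivDiff b ω f = wordDivDiff b ω' f →
      wordDivDiff b ω (lin x * f) = wordDivDiff b ω' (lin x * f)) (f : Sym V) :
    wordDivDiff b ω f = wordDivDiff b ω' f := by
  have key (a : Sym V) : ∀ f, wordDivDiff b ω f = wordDivDiff b ω' f →
      wordDivDiff b ω (a * f) = wordDivDiff b ω' (a * f) := by
    induction a using SymmetricAlgebra.induction with
    | algebraMap r =>
      intro f hf
      rw [wordDivDiff_algebraMap_mul, wordDivDiff_algebraMap_mul, hf]
    | ι x => exact h x
    | mul a c ha hc =>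
      intro f hf
      rw [mul_assoc]
      exact ha _ (hc _ hf)
    | add a c ha hc =>
      intro f hf
      rw [add_mul, wordDivDiff_add, wordDivDiff_add, ha f hf, hc f hf]
  rw [← mul_one f]
  refine key f 1 ?_
  by_cases hω : ω = []
  · subst hω
    rw [List.length_eq_zero_iff.1 hl.symm]
  · have hω' : ω' ≠ [] := by
      rintro rfl
      exact hω (List.length_eq_zero_iff.1 hl)
    rw [wordDivDiff_one hω, wordDivDiff_one hω']

/-- The operator of a word depends only on the length of the word and on its product, and is zero
if the word is not reduced. -/
lemma wordDivDiff_eq [Finite ι] (ω : List b.support) (f : Sym V) :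
    wordDivDiff b ω f = divDiffOfLength b ω.length (wordProd b ω) f := by
  cases nonempty_fintype ι
  induction hn : ω.length using Nat.strong_induction_on generalizing ω f with
  | _ n ih =>
    replace ih (ω : List b.support) (h : ω.length < n) (f : Sym V) :
        wordDivDiff b ω f = divDiffOfLength b ω.length (wordProd b ω) f := ih _ h ω f rfl
    rw [divDiffOfLength]
    split_ifs with h
    · obtain ⟨h1, h2⟩ := (exists_isReducedWord b (wordProd b ω)).choose_spec
      rw [divDiffW]
      set ω' := (exists_isReducedWord b (wordProd b ω)).choose
      have hω : IsReducedWord b ω := h.trans hn.symm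
      have hl : ω.length = ω'.length := by
        rw [IsReducedWord, h2, h] at h1
        omega
      refine wordDivDiff_eq_of_lin_mul hl (fun x g hg => ?_) f
      rw [wordDivDiff_lin_mul ih ω hn.le hω, wordDivDiff_lin_mul ih ω' (by omega) h1, h2, hg, hl]
    · cases ω with
      | nil => exact absurd (by rw [wordProd_nil, length_one, ← hn]; rfl) h
      | cons i ω =>
        rw [wordProd_cons] at h
        rw [List.length_cons] at hn
        rw [wordDivDiff, ih ω (by omega) f]
        by_cases hω : length b (wordProd b ω) = ω.length
        · by_cases hp : b.IsPos ((wordProd b ω)⁻¹ • (i : ι))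
          · exact absurd (by rw [length_simple_mul_of_isPos i hp, hω, hn]) h
          · have h1 := length_simple_mul_of_not_isPos i hp
            obtain ⟨ω', h2, h3⟩ :=
              exists_word_length_eq (b := b) (weylGroup.ofIdx P (i : ι) * wordProd b ω)
            have h4 := ih (i :: ω') (by rw [List.length_cons]; omega) f
            rw [wordProd_cons, h2, ofIdx_mul_cancel_left, List.length_cons, h3, h1, hω] at h4
            rw [← h4, wordDivDiff, divDiff_divDiff]
        · rw [divDiffOfLength, if_neg hω, divDiff_zero]

variable [Finite ι]

lemma divDiffW_wordProd {ω : List b.support} (h : IsReducedWord b ω) :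
    divDiffW b (wordProd b ω) = wordDivDiff b ω := by
  ext f : 1
  rw [wordDivDiff_eq]
  exact (if_pos h).symm

@[simp] lemma divDiffW_one (f : Sym V) : divDiffW b 1 f = f := by
  have : IsReducedWord b [] := length_one
  rw [← wordProd_nil, divDiffW_wordProd this]
  rfl

open scoped Classical in
lemma divDiff_divDiffW (i : b.support) (w : P.weylGroup) (f : Sym V) :
    divDiff P i (divDiffW b w f) =
      if length b (weylGroup.ofIdx P (i : ι) * w) = length b w + 1 then
        divDiffW b (weylGroup.ofIdx P (i : ι) * w) f else 0 := by
  obtain ⟨ω, h, rfl⟩ := exists_isReducedWord b w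
  rw [divDiffW_wordProd h]
  change wordDivDiff b (i :: ω) f = _
  rw [wordDivDiff_eq, divDiffOfLength, List.length_cons, wordProd_cons, h]

end WordDivDiff

section Homogeneous

lemma IsHomogeneousOfDegree.zero (d : ℕ) : IsHomogeneousOfDegree d (0 : Sym V) :=
  Submodule.zero_mem _

lemma isHomogeneousOfDegree_one : IsHomogeneousOfDegree 0 (1 : Sym V) := by
  rw [IsHomogeneousOfDegree, pow_zero]
  exact Submodule.one_le.1 le_rfl

lemma isHomogeneousOfDegree_lin (x : V) : IsHomogeneousOfDegree 1 (lin x : Sym V) := by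
  rw [IsHomogeneousOfDegree, pow_one]
  exact LinearMap.mem_range_self _ x

lemma IsHomogeneousOfDegree.mul {d e : ℕ} {f g : Sym V} (hf : IsHomogeneousOfDegree d f)
    (hg : IsHomogeneousOfDegree e g) : IsHomogeneousOfDegree (d + e) (f * g) := by
  rw [IsHomogeneousOfDegree, pow_add]
  exact Submodule.mul_mem_mul hf hg

lemma IsHomogeneousOfDegree.sub {d : ℕ} {f g : Sym V} (hf : IsHomogeneousOfDegree d f)
    (hg : IsHomogeneousOfDegree d g) : IsHomogeneousOfDegree d (f - g) :=
  Submodule.sub_mem _ hf hg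

lemma IsHomogeneousOfDegree.neg_one_pow_mul {d : ℕ} {f : Sym V} (hf : IsHomogeneousOfDegree d f)
    (n : ℕ) : IsHomogeneousOfDegree d ((-1) ^ n * f) := by
  rcases neg_one_pow_eq_or (Sym V) n with h | h <;> rw [h]
  · rwa [one_mul]
  · rw [neg_one_mul]
    exact Submodule.neg_mem _ hf

lemma IsHomogeneousOfDegree.prod_lin {κ : Type*} (s : Finset κ) (x : κ → V) :
    IsHomogeneousOfDegree s.card (∏ k ∈ s, lin (x k) : Sym V) := by
  classical
  induction s using Finset.induction_on with
  | empty => simpa using isHomogeneousOfDegree_one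
  | insert a s ha ih =>
    rw [Finset.prod_insert ha, Finset.card_insert_of_notMem ha, add_comm]
    exact (isHomogeneousOfDegree_lin _).mul ih

lemma IsHomogeneousOfDegree.act {P : RootPairing ι ℝ V N} (w : P.weylGroup) {d : ℕ} {f : Sym V}
    (hf : IsHomogeneousOfDegree d f) : IsHomogeneousOfDegree d (act P w f) := by
  have h := Submodule.mem_map_of_mem (f := (FlagGKM.act P w).toLinearMap) hf
  rw [Submodule.map_pow] at h
  have hle : Submodule.map (FlagGKM.act P w).toLinearMap (LinearMap.range lin) ≤
      LinearMap.range (lin : V →ₗ[ℝ] Sym V) := by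
    rintro _ ⟨_, ⟨x, rfl⟩, rfl⟩
    exact ⟨w • x, (act_lin P w x).symm⟩
  have hpow := pow_le_pow_left' hle d
  exact hpow h

end Homogeneous

section Coefficients

variable {P : RootPairing ι ℝ V N} (b : P.Base) [Fintype ι] [P.IsRootSystem]
  [P.IsCrystallographic] [P.IsReduced]

/-- The action of `v` on `S(𝔱*)` is a combination of the operators `∂_w`. -/
lemma exists_act_eq_sum_divDiffW (v : P.weylGroup) : ∃ c : P.weylGroup → Sym V,
    (∀ f, act P v f = ∑ w, c w * divDiffW b w f) ∧
    (∀ w, IsHomogeneousOfDegree (length b w) (c w)) ∧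
    (∀ w, ¬ BruhatLE b w v → c w = 0) ∧
    c v = (-1) ^ length b v * ∏ i ∈ inversions b v, lin (P.root i) := by
  classical
  induction v using weylGroup_induction_length b with
  | one =>
    refine ⟨fun w => if w = 1 then 1 else 0, fun f => ?_, fun w => ?_, fun w hw => ?_, ?_⟩
    · simp
    · dsimp only
      split_ifs with h
      · rw [h, length_one]
        exact isHomogeneousOfDegree_one
      · exact IsHomogeneousOfDegree.zero _
    · refine if_neg ?_
      rintro rfl
      exact hw (BruhatLE.refl _)
    · simp
  | mul i v h ih =>
    obtain ⟨c, h1, h2, h3, h4⟩ := ih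
    set s := weylGroup.ofIdx P (i : ι) with hs
    have hlt : length b v < length b (s * v) := by omega
    refine ⟨fun w => act P s (c w) - if length b w = length b (s * w) + 1 then
      lin (P.root i) * act P s (c (s * w)) else 0, fun f => ?_, fun w => ?_, fun w hw => ?_, ?_⟩
    · simp only [sub_mul, Finset.sum_sub_distrib]
      rw [← Equiv.sum_comp (Equiv.mulLeft s) fun w => (if length b w = length b (s * w) + 1 then
        lin (P.root i) * act P s (c (s * w)) else 0) * divDiffW b w f, ← Finset.sum_sub_distrib,
        act_mul, h1, map_sum]
      refine Finset.sum_congr rfl fun w _ => ?_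
      rw [Equiv.coe_mulLeft, hs, ofIdx_mul_cancel_left, map_mul, act_eq_sub _ (divDiffW b w f),
        divDiff_divDiffW]
      split_ifs
      · ring
      · ring
    · refine IsHomogeneousOfDegree.sub ((h2 w).act s) ?_
      split_ifs with hw
      · rw [hw, add_comm]
        exact (isHomogeneousOfDegree_lin _).mul ((h2 _).act s)
      · exact IsHomogeneousOfDegree.zero _
    · have hw1 : c w = 0 := h3 w fun h' => hw (h'.trans (bruhatLE_ofIdx_mul hlt))
      dsimp only
      rw [hw1, map_zero, zero_sub, neg_eq_zero]
      split_ifs with hl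
      · rw [h3 (s * w), map_zero, mul_zero]
        intro h'
        have := h'.simple_mul i hlt
        rw [hs, ofIdx_mul_cancel_left] at this
        exact hw this
      · rfl
    · have hv : c (s * v) = 0 := h3 _ fun h' => by
        rcases h'.eq_or_length_lt with h' | h'
        · rw [h'] at hlt; exact lt_irrefl _ hlt
        · omega
      dsimp only
      rw [hv, hs, ofIdx_mul_cancel_left, if_pos h, h4, h, prod_inversions_simple_mul _ i h, map_zero,
        map_mul, map_prod, map_pow, map_neg, map_one]
      simp only [act_lin, root_smul]
      ring

/-- The coefficient of `∂_w` in the action of `v`. -/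
def actCoeff (v w : P.weylGroup) : Sym V := (exists_act_eq_sum_divDiffW b v).choose w

lemma act_eq_sum_actCoeff (v : P.weylGroup) (f : Sym V) :
    act P v f = ∑ w, actCoeff b v w * divDiffW b w f :=
  (exists_act_eq_sum_divDiffW b v).choose_spec.1 f

lemma actCoeff_isHomogeneousOfDegree (v w : P.weylGroup) :
    IsHomogeneousOfDegree (length b w) (actCoeff b v w) :=
  (exists_act_eq_sum_divDiffW b v).choose_spec.2.1 w

lemma actCoeff_eq_zero {v w : P.weylGroup} (h : ¬ BruhatLE b w v) : actCoeff b v w = 0 :=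
  (exists_act_eq_sum_divDiffW b v).choose_spec.2.2.1 w h

lemma actCoeff_self (v : P.weylGroup) :
    actCoeff b v v = (-1) ^ length b v * ∏ i ∈ inversions b v, lin (P.root i) :=
  (exists_act_eq_sum_divDiffW b v).choose_spec.2.2.2

lemma actCoeff_self_ne_zero (v : P.weylGroup) : actCoeff b v v ≠ 0 := by
  rw [actCoeff_self]
  exact mul_ne_zero (pow_ne_zero _ (neg_ne_zero.2 one_ne_zero))
    (Finset.prod_ne_zero_iff.2 fun i _ => lin_root_ne_zero i)

lemma lin_injective : Function.Injective (lin : V →ₗ[ℝ] Sym V) := by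
  rw [← LinearMap.ker_eq_bot, LinearMap.ker_eq_bot']
  intro x hx
  rw [← Module.forall_dual_apply_eq_zero_iff ℝ]
  intro φ
  have h : SymmetricAlgebra.lift φ (lin x) = φ x := by simp
  rw [← h, hx, map_zero]

omit [P.IsRootSystem] [P.IsCrystallographic] [P.IsReduced] [Fintype ι] in
variable (P) in
lemma linearIndependent_act :
    LinearIndependent (Sym V) fun (w : P.weylGroup) (f : Sym V) => act P w f := by
  refine (linearIndependent_monoidHom (Sym V) (Sym V)).comp
    (fun w : P.weylGroup => (act P w : Sym V →* Sym V)) fun w w' h => ?_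
  apply weylGroup_ext
  intro x
  apply lin_injective
  rw [← act_lin, ← act_lin]
  exact DFunLike.congr_fun h (lin x)

lemma linearIndependent_divDiffW :
    LinearIndependent (Sym V) fun w : P.weylGroup => divDiffW b w := by
  classical
  let C : Matrix P.weylGroup P.weylGroup (Sym V) := Matrix.of (actCoeff b)
  have hC : C.det ≠ 0 := by
    intro h0
    obtain ⟨x, hx0, hx⟩ := Matrix.exists_mulVec_eq_zero_iff.2 h0
    refine hx0 (funext fun w => ?_)
    induction hn : length b w using Nat.strong_induction_on generalizing w with
    | _ n ih =>
      have h1 := congrFun hx w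
      rw [Matrix.mulVec, dotProduct, Finset.sum_eq_single w] at h1
      · exact (mul_eq_zero.1 h1).resolve_left (actCoeff_self_ne_zero b w)
      · intro w' _ hw'
        by_cases hle : BruhatLE b w' w
        · have := hle.eq_or_length_lt.resolve_left hw'
          rw [ih _ (hn ▸ this) w' rfl]
          exact mul_zero _
        · change actCoeff b w w' * _ = 0
          rw [actCoeff_eq_zero b hle, zero_mul]
      · simp
  rw [Fintype.linearIndependent_iff]
  intro a ha
  have h1 : Matrix.vecMul (Matrix.vecMul a C.adjugate) C = C.det • a := by
    rw [Matrix.vecMul_vecMul, Matrix.adjugate_mul, Matrix.vecMul_smul, Matrix.vecMul_one]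
  have h2 : Matrix.vecMul a C.adjugate = 0 := by
    refine funext (Fintype.linearIndependent_iff.1 (linearIndependent_act P) _ ?_)
    ext f : 1
    have h3 := congrFun ha f
    simp only [Finset.sum_apply, Pi.smul_apply, smul_eq_mul, Pi.zero_apply] at h3 ⊢
    have h4 : (∑ v, Matrix.vecMul a C.adjugate v * act P v f) =
        ∑ w, Matrix.vecMul (Matrix.vecMul a C.adjugate) C w * divDiffW b w f := by
      simp only [act_eq_sum_actCoeff b _ f, Finset.mul_sum]
      rw [Finset.sum_comm]
      refine Finset.sum_congr rfl fun w _ => ?_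
      rw [Matrix.vecMul, dotProduct, Finset.sum_mul]
      exact Finset.sum_congr rfl fun v _ => (mul_assoc _ _ _).symm
    rw [h4, h1]
    simp only [Pi.smul_apply, smul_eq_mul, mul_assoc]
    rw [← Finset.mul_sum, h3, mul_zero]
  rw [h2, Matrix.zero_vecMul] at h1
  intro w
  exact (mul_eq_zero.1 (congrFun h1 w).symm).resolve_left hC

/-- The operators on `S(𝔱*)` that are `S(𝔱*)`-combinations of the operators `∂_w`. -/
def divDiffSpan : Submodule (Sym V) (Sym V → Sym V) :=
  Submodule.span (Sym V) (Set.range fun w : P.weylGroup => divDiffW b w)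

variable {b}

lemma act_mem_divDiffSpan (v : P.weylGroup) : (fun f => act P v f) ∈ divDiffSpan b := by
  rw [divDiffSpan, Submodule.mem_span_range_iff_exists_fun]
  refine ⟨actCoeff b v, ?_⟩
  ext f : 1
  simp [act_eq_sum_actCoeff b v f]

omit [P.IsRootSystem] in
lemma divDiff_mem_divDiffSpan (i : b.support) {g : Sym V → Sym V} (hg : g ∈ divDiffSpan b) :
    (fun f => divDiff P i (g f)) ∈ divDiffSpan b := by
  classical
  induction hg using Submodule.span_induction with
  | mem g hg =>
    obtain ⟨w, rfl⟩ := hg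
    simp only [divDiff_divDiffW]
    split_ifs
    · exact Submodule.subset_span ⟨_, rfl⟩
    · exact Submodule.zero_mem _
  | zero =>
    simp only [Pi.zero_apply, divDiff_zero]
    exact Submodule.zero_mem _
  | add g h _ _ hg hh =>
    simp only [Pi.add_apply, divDiff_add]
    exact Submodule.add_mem _ hg hh
  | smul a g hg' hg =>
    simp only [Pi.smul_apply, smul_eq_mul, divDiff_mul]
    exact Submodule.add_mem _ (Submodule.smul_mem _ (divDiff P i a) hg')
      (Submodule.smul_mem _ (act P (weylGroup.ofIdx P (i : ι)) a) hg)

omit [P.IsRootSystem] in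
lemma act_comp_mem_divDiffSpan (v : P.weylGroup) {g : Sym V → Sym V} (hg : g ∈ divDiffSpan b) :
    (fun f => act P v (g f)) ∈ divDiffSpan b := by
  induction v using weylGroup_induction_length b with
  | one => simpa using hg
  | mul i v _ ih =>
    simp only [act_mul, act_eq_sub (i : ι)]
    exact Submodule.sub_mem _ ih
      (Submodule.smul_mem _ (lin (P.root i)) (divDiff_mem_divDiffSpan i ih))

omit [P.IsRootSystem] in
variable (b) in
lemma exists_smul_simple_eq (β : ι) : ∃ (y : P.weylGroup) (i : b.support), y • (i : ι) = β := by
  refine b.induction_reflect β (p := fun β => ∃ (y : P.weylGroup) (i : b.support), y • (i : ι) = β)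
    ?_ ?_ ?_
  · rintro _ ⟨y, i, rfl⟩
    exact ⟨weylGroup.ofIdx P (y • (i : ι)) * y, i, by rw [mul_smul, ofIdx_smul_index]⟩
  · exact fun i hi => ⟨1, ⟨i, hi⟩, one_smul _ _⟩
  · rintro _ j ⟨y, i, rfl⟩ _
    exact ⟨weylGroup.ofIdx P j * y, i, by rw [mul_smul, ofIdx_smul_index]⟩

lemma exists_act_mul_ofIdx_sub (v : P.weylGroup) (β : ι) : ∃ h ∈ divDiffSpan b,
    ∀ f, act P (v * weylGroup.ofIdx P β) f - act P v f = lin (v • P.root β) * h f := by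
  obtain ⟨y, i, rfl⟩ := exists_smul_simple_eq b β
  refine ⟨_, Submodule.neg_mem _ (act_comp_mem_divDiffSpan (v * y)
    (divDiff_mem_divDiffSpan i (act_mem_divDiffSpan y⁻¹))), fun f => ?_⟩
  rw [ofIdx_smul_eq_conj, ← mul_assoc, ← mul_assoc, act_mul, act_mul _ (v * y), act_eq_sub, map_sub,
    ← act_mul, mul_inv_cancel_right, map_mul, act_lin, root_smul, mul_smul, Pi.neg_apply]
  ring

lemma dvd_actCoeff_sub (v w : P.weylGroup) (β : ι) :
    lin (v • P.root β) ∣ actCoeff b (v * weylGroup.ofIdx P β) w - actCoeff b v w := by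
  obtain ⟨h, hh, h1⟩ := exists_act_mul_ofIdx_sub (b := b) v β
  rw [divDiffSpan, Submodule.mem_span_range_iff_exists_fun] at hh
  obtain ⟨d, rfl⟩ := hh
  refine ⟨d w, sub_eq_zero.1 ?_⟩
  refine Fintype.linearIndependent_iff.1 (linearIndependent_divDiffW b) (fun w =>
    actCoeff b (v * weylGroup.ofIdx P β) w - actCoeff b v w - lin (v • P.root β) * d w) ?_ w
  ext f : 1
  have h2 := sub_eq_zero.2 (h1 f)
  rw [act_eq_sum_actCoeff b, act_eq_sum_actCoeff b] at h2
  simpa [sub_mul, Finset.sum_sub_distrib, Finset.mul_sum, mul_assoc] using h2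

end Coefficients

section LinearForms

lemma prime_lin {x : V} (hx : x ≠ 0) : Prime (lin x : Sym V) := by
  have hli : LinearIndepOn ℝ id {x} := (linearIndepOn_singleton_iff ℝ).2 hx
  let B := Module.Basis.extend hli
  let k : hli.extend (Set.subset_univ _) := ⟨x, hli.subset_extend (Set.subset_univ _) rfl⟩
  have hk : SymmetricAlgebra.equivMvPolynomial B (lin x) = MvPolynomial.X k := by
    rw [← SymmetricAlgebra.equivMvPolynomial_ι_apply B k, Module.Basis.extend_apply_self]
  rw [← MulEquiv.prime_iff (SymmetricAlgebra.equivMvPolynomial B), hk]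
  exact MvPolynomial.X_prime

lemma not_lin_dvd_lin {x y : V} (h : LinearIndependent ℝ ![x, y]) :
    ¬ (lin x : Sym V) ∣ lin y := by
  have hx : x ≠ 0 := h.ne_zero 0
  have hy : y ∉ Submodule.span ℝ {x} := by
    rw [Submodule.mem_span_singleton]
    rintro ⟨a, ha⟩
    exact (LinearIndependent.pair_iff' hx).1 h a ha
  obtain ⟨φ, hφ, hle⟩ := Submodule.exists_le_ker_of_notMem hy
  intro hdvd
  have h1 := map_dvd (SymmetricAlgebra.lift φ) hdvd
  have h2 : φ x = 0 := hle (Submodule.mem_span_singleton_self x)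
  rw [SymmetricAlgebra.lift_ι_apply, SymmetricAlgebra.lift_ι_apply, h2, zero_dvd_iff] at h1
  exact hφ h1

lemma prod_dvd_of_prime_of_not_dvd {R κ : Type*} [CommRing R] [IsDomain R] {s : Finset κ}
    {p : κ → R} {n : R} (hp : ∀ k ∈ s, Prime (p k))
    (hne : ∀ k ∈ s, ∀ l ∈ s, k ≠ l → ¬ p k ∣ p l) (hn : ∀ k ∈ s, p k ∣ n) :
    ∏ k ∈ s, p k ∣ n := by
  classical
  induction s using Finset.induction_on with
  | empty => simp
  | insert a s ha ih =>
    obtain ⟨q, rfl⟩ := ih (fun k hk => hp k (Finset.mem_insert_of_mem hk))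
      (fun k hk l hl => hne k (Finset.mem_insert_of_mem hk) l (Finset.mem_insert_of_mem hl))
      (fun k hk => hn k (Finset.mem_insert_of_mem hk))
    have hpa := hp a (Finset.mem_insert_self a s)
    rw [Finset.prod_insert ha, mul_comm]
    refine mul_dvd_mul_left _ ((hpa.dvd_or_dvd (hn a (Finset.mem_insert_self a s))).resolve_left ?_)
    rw [hpa.dvd_finsetProd_iff]
    rintro ⟨l, hl, hal⟩
    exact hne a (Finset.mem_insert_self a s) l (Finset.mem_insert_of_mem hl)
      (fun h => ha (h ▸ hl)) hal

lemma IsHomogeneousOfDegree.equivMvPolynomial {κ : Type*} (B : Module.Basis κ ℝ V) {d : ℕ}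
    {f : Sym V} (hf : IsHomogeneousOfDegree d f) :
    (SymmetricAlgebra.equivMvPolynomial B f).IsHomogeneous d := by
  let e : Sym V →ₐ[ℝ] MvPolynomial κ ℝ := SymmetricAlgebra.equivMvPolynomial B
  have h := Submodule.mem_map_of_mem (f := e.toLinearMap) hf
  rw [Submodule.map_pow] at h
  have hle : Submodule.map e.toLinearMap (LinearMap.range lin) ≤
      MvPolynomial.homogeneousSubmodule κ ℝ 1 := by
    rw [← LinearMap.range_comp, LinearMap.range_eq_map, ← B.span_eq, Submodule.map_span,
      Submodule.span_le]
    rintro _ ⟨_, ⟨k, rfl⟩, rfl⟩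
    have : (e.toLinearMap ∘ₗ lin) (B k) = MvPolynomial.X k :=
      SymmetricAlgebra.equivMvPolynomial_ι_apply B k
    rw [this]
    exact MvPolynomial.isHomogeneous_X ℝ k
  have hpow := pow_le_pow_left' hle d
  rw [MvPolynomial.homogeneousSubmodule_one_pow] at hpow
  exact hpow h

lemma IsHomogeneousOfDegree.le_of_dvd {d e : ℕ} {f g : Sym V} (hf : IsHomogeneousOfDegree d f)
    (hg : IsHomogeneousOfDegree e g) (hg0 : g ≠ 0) (h : f ∣ g) : d ≤ e := by
  obtain ⟨q, rfl⟩ := h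
  let B := Module.Basis.ofVectorSpace ℝ V
  let φ := SymmetricAlgebra.equivMvPolynomial B
  have hne (r : Sym V) (hr : r ≠ 0) : φ r ≠ 0 := (map_ne_zero_iff φ φ.injective).2 hr
  have h1 := (hg.equivMvPolynomial B).totalDegree (hne _ hg0)
  have h2 := (hf.equivMvPolynomial B).totalDegree (hne _ (left_ne_zero_of_mul hg0))
  rw [map_mul, MvPolynomial.totalDegree_mul_of_isDomain (hne _ (left_ne_zero_of_mul hg0))
    (hne _ (right_ne_zero_of_mul hg0)), h2] at h1
  omega

end LinearForms

section SchubertClass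

variable {P : RootPairing ι ℝ V N} {b : P.Base} [Fintype ι] [P.IsCrystallographic] [P.IsReduced]

omit [Fintype ι] [P.IsCrystallographic] in
lemma not_lin_root_dvd {i j : ι} (hi : b.IsPos i) (hj : b.IsPos j) (hij : i ≠ j) :
    ¬ (lin (P.root i) : Sym V) ∣ lin (P.root j) := by
  refine not_lin_dvd_lin (IsReduced.linearIndependent P hij fun h => ?_)
  rw [← P.reflection_apply_self, ← P.root_reflectionPerm] at h
  rw [P.root.injective h] at hi
  exact isPos_neg.1 hi hj

/-- If `g` satisfies the GKM condition and vanishes at all elements shorter than `v`, then the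
product of the inversions of `v` divides `g v`. -/
lemma prod_inversions_dvd {g : P.weylGroup → Sym V} (hg : g ∈ cohomology b) {v : P.weylGroup}
    (h : ∀ w, length b w < length b v → g w = 0) :
    ∏ i ∈ inversions b v, lin (P.root i) ∣ g v := by
  refine prod_dvd_of_prime_of_not_dvd (fun i _ => prime_lin (P.ne_zero i))
    (fun i hi j hj hij => not_lin_root_dvd (mem_inversions.1 hi).1 (mem_inversions.1 hj).1 hij)
    fun i hi => ?_
  obtain ⟨h1, h2⟩ := mem_inversions.1 hi
  have h3 := hg v _ (isPos_neg.2 h2)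
  rw [ofIdx_neg, ← ofIdx_mul_eq, h _ ((length_ofIdx_mul_lt_iff h1).2 h2), zero_sub, dvd_neg,
    ← root_smul, smul_neg_index, smul_inv_smul, P.root_reflectionPerm, P.reflection_apply_self,
    map_neg, neg_dvd] at h3
  exact h3

lemma IsSchubertClass.unique {u : P.weylGroup} {τ τ' : cohomology b} (h : IsSchubertClass b u τ)
    (h' : IsSchubertClass b u τ') : τ = τ' := by
  rw [← sub_eq_zero]
  set g : cohomology b := τ - τ' with hgdef
  have hval (v : P.weylGroup) : (g : P.weylGroup → Sym V) v =
    (τ : P.weylGroup → Sym V) v - (τ' : P.weylGroup → Sym V) v := rfl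
  apply Subtype.ext
  funext v
  change (g : P.weylGroup → Sym V) v = 0
  induction hn : length b v using Nat.strong_induction_on generalizing v with
  | _ n ih =>
    by_contra hv
    have hle : BruhatLE b u v := by
      by_contra hle
      exact hv (by rw [hval, h.support v hle, h'.support v hle, sub_zero])
    rcases hle.eq_or_length_lt with rfl | hlt
    · exact hv (by rw [hval, h.normalized, h'.normalized, sub_self])
    · have hdvd := prod_inversions_dvd g.2 (v := v) fun w hw => ih _ (hn ▸ hw) w rfl
      have hhom : IsHomogeneousOfDegree (length b u) ((g : P.weylGroup → Sym V) v) :=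
        (h.homogeneous v).sub (h'.homogeneous v)
      have := (IsHomogeneousOfDegree.prod_lin (inversions b v) P.root).le_of_dvd hhom hv hdvd
      rw [card_inversions] at this
      omega

variable [P.IsRootSystem]

lemma isSchubertClass_actCoeff (u : P.weylGroup) : IsSchubertClass b u
    ⟨fun v => (-1) ^ length b u * actCoeff b v u, fun v i _ => by
      rw [← mul_sub]
      exact (dvd_actCoeff_sub v u i).mul_left _⟩ where
  homogeneous v := (actCoeff_isHomogeneousOfDegree b v u).neg_one_pow_mul _
  support v hv := by
    change _ * actCoeff b v u = 0
    rw [actCoeff_eq_zero b hv, mul_zero]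
  normalized := by
    change _ * actCoeff b u u = _
    rw [actCoeff_self, ← mul_assoc, ← mul_pow, neg_one_mul, neg_neg, one_pow, one_mul]
    rfl

lemma isSchubertClass_schubertClass (u : P.weylGroup) :
    IsSchubertClass b u (schubertClass b u) :=
  Classical.epsilon_spec ⟨_, isSchubertClass_actCoeff u⟩

lemma schubertClass_apply (u v : P.weylGroup) :
    (schubertClass b u : P.weylGroup → Sym V) v = (-1) ^ length b u * actCoeff b v u := by
  rw [(isSchubertClass_schubertClass u).unique (isSchubertClass_actCoeff u)]

lemma charClass_eq_sum (f : Sym V) : charClass b f =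
    ∑ w : P.weylGroup, ((-1) ^ length b w * divDiffW b w f) • schubertClass b w := by
  apply Subtype.ext
  funext v
  rw [AddSubmonoidClass.coe_finsetSum, Finset.sum_apply]
  change act P v f = _
  rw [act_eq_sum_actCoeff b v f]
  refine Finset.sum_congr rfl fun w _ => ?_
  change _ = _ * (schubertClass b w : P.weylGroup → Sym V) v
  rw [schubertClass_apply, mul_mul_mul_comm, ← mul_pow, neg_one_mul, neg_neg, one_pow, one_mul,
    mul_comm]

end SchubertClass

end FlagGKM

end

theorem mainTheorem10 {ι V N : Type*} [Fintype ι] [AddCommGroup V] [Module ℝ V]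
    [AddCommGroup N] [Module ℝ N] (P : RootPairing ι ℝ V N)
    [P.IsRootSystem] [P.IsCrystallographic] [P.IsReduced] (b : P.Base) :
    (∀ u : P.weylGroup, ∃! τ : FlagGKM.cohomology b, FlagGKM.IsSchubertClass b u τ) ∧
    (∀ ω : List b.support, FlagGKM.IsReducedWord b ω →
      FlagGKM.divDiffW b (FlagGKM.wordProd b ω) = FlagGKM.wordDivDiff b ω) ∧
    ∀ f : FlagGKM.Sym V,
      FlagGKM.charClass b f =
        ∑ w : P.weylGroup,
          ((-1) ^ FlagGKM.length b w * FlagGKM.divDiffW b w f) • FlagGKM.schubertClass b w :=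
  ⟨fun u => ⟨_, FlagGKM.isSchubertClass_actCoeff u,
    fun _ h => h.unique (FlagGKM.isSchubertClass_actCoeff u)⟩,
    fun _ => FlagGKM.divDiffW_wordProd, FlagGKM.charClass_eq_sum⟩
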